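/- Let $n\ge 1$ be an integer and let $D$ be a set of positive divisors of $n$, all different from $n$. The integral circulant graph $\mathrm{ICG}_n(D)$ has vertex set $\mathbb{Z}/n\mathbb{Z}$, and two vertices $a,b$ are adjacent if and only if $\gcd(a-b,n)\in D$. A graph with adjacency matrix $A$ has perfect state transfer (PST) if there are distinct vertices $a,b$ and a real number $t>0$ such that $|\exp(\mathrm{i}At)_{ab}|=1$. For $i\ge 0$ put $D_i=\{d\in D : 2^i\mid n/d,\ 2^{i+1}\nmid n/d\}$, and for a set $E$ of integers and an integer $k\geq 1$ write $kE=\{ke : e\in E\}$. If $\mathrm{ICG}_n(D)$ has PST, then $$D_1\setminus\{n/2\}=2\,(D_2\setminus\{n/4\}),\qquad D_0=2\,(D_1\setminus\{n/2\}),$$ and consequently $D_0=4\,(D_2\setminus\{n/4\})$. -/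

import Mathlib

/-- The integral circulant graph `ICG_n(D)`: its vertex set is `ℤ/nℤ`, and distinct vertices
`a`, `b` are adjacent iff `gcd(a - b, n) ∈ D`. -/
def ICG (n : ℕ) [NeZero n] (D : Finset ℕ) : SimpleGraph (ZMod n) where
  Adj a b := a ≠ b ∧ Nat.gcd (a - b).val n ∈ D
  symm := ⟨by
    rintro a b ⟨hab, h⟩
    refine ⟨hab.symm, ?_⟩
    have hne : a - b ≠ 0 := sub_ne_zero.mpr hab
    have hv : (b - a).val = n - (a - b).val := by
      have : NeZero (a - b) := ⟨hne⟩
      rw [← neg_sub a b, ZMod.val_neg_of_ne_zero]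
    rw [hv, Nat.gcd_comm, Nat.gcd_self_sub_right (ZMod.val_lt _).le, Nat.gcd_comm]
    exact h⟩
  loopless := ⟨fun _ h => h.1 rfl⟩

instance (n : ℕ) [NeZero n] (D : Finset ℕ) : DecidableRel (ICG n D).Adj :=
  fun a b => inferInstanceAs (Decidable (a ≠ b ∧ Nat.gcd (a - b).val n ∈ D))

/-- The time evolution matrix `F(t) = exp(i A t)` of the graph `G` with adjacency matrix `A`. -/
noncomputable def timeEvolution {V : Type*} [Fintype V] [DecidableEq V]
    (G : SimpleGraph V) [DecidableRel G.Adj] (t : ℝ) : Matrix V V ℂ :=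
  NormedSpace.exp ((Complex.I * (t : ℂ)) • G.adjMatrix ℂ)

/-- Perfect state transfer: `|F(t)_{ab}| = 1` for some distinct vertices `a`, `b` and
some real number `t > 0`. -/
def HasPST {V : Type*} [Fintype V] [DecidableEq V]
    (G : SimpleGraph V) [DecidableRel G.Adj] : Prop :=
  ∃ a b : V, a ≠ b ∧ ∃ t : ℝ, 0 < t ∧ ‖timeEvolution G t a b‖ = 1

/-- `D_i = {d ∈ D | S_2(n/d) = i}`, where `S_2` is the 2-adic valuation. -/
def divisorLevel (n : ℕ) (D : Finset ℕ) (i : ℕ) : Finset ℕ :=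
  D.filter (fun d => padicValNat 2 (n / d) = i)

/-- The set `kD = {k d | d ∈ D}`. -/
def scaleSet (k : ℕ) (D : Finset ℕ) : Finset ℕ :=
  D.image (fun d => k * d)

/-! Write `a(z)` for `gcdIndicator n D z`, `λ_j` for `icgEigenvalue n D j`, and `n = 2^k * N` with
`N` odd. The characters of `ℤ/nℤ` are eigenvectors of the graph, and its eigenvalues `λ_j` are sums
of Ramanujan sums, hence integers. Unitarity and `λ_{-j} = λ_j` show that perfect state transfer
makes `exp (i t λ_j)` alternate with `j`. So some `2^e` divides every `λ_i - λ_j` with `i ≡ j` mod 2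
but not `λ_1 - λ_0` (`exists_two_pow_dvd_sub_of_phase`).

Fourier inversion over the indices `j + 2^k * y` turns this into congruences mod `2^e` for sums of
`a` over cosets of the `2^k`-torsion (`two_pow_dvd_fibre_sum`). With `j = 2^s` most terms cancel
(`sum_two_primary_eq`), leaving only shifts by multiples of `n / 2^(s+1)`. The coset through `0`
forces `e ≥ 2`. The coset through `n/m`, `m > 1` odd, then shows mod 4 that `n/m`, `n/(2m)`,
`n/(4m)` lie in `D` together or not at all (`HasPST.mem_iff`). These quotients run over the three
sets of the theorem, since deleting `n/2` and `n/4` discards `m = 1`. -/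

open ZMod (stdAddChar)

/-- The indicator of the residues `z` modulo `n` with `gcd(z, n) ∈ D`, the connection set of
`ICG n D`. -/
def gcdIndicator (n : ℕ) (D : Finset ℕ) (z : ZMod n) : ℤ :=
  if Nat.gcd z.val n ∈ D then 1 else 0

theorem gcdIndicator_natCast (n : ℕ) (D : Finset ℕ) (a : ℕ) :
    gcdIndicator n D (a : ZMod n) = if Nat.gcd a n ∈ D then 1 else 0 := by
  rw [gcdIndicator, ZMod.val_natCast, ← Nat.gcd_rec, Nat.gcd_comm]

/-- The `j`-th eigenvalue of `ICG n D`: the Fourier transform of its connection set. -/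
noncomputable def icgEigenvalue (n : ℕ) [NeZero n] (D : Finset ℕ) (j : ZMod n) : ℂ :=
  ∑ z : ZMod n, (gcdIndicator n D z : ℂ) * stdAddChar (j * z)

/-! ### Integrality of the eigenvalues -/

section Integrality

variable {n : ℕ} [NeZero n]

theorem dvd_val_add_natCast_iff {d : ℕ} (hd : d ∣ n) (z : ZMod n) :
    d ∣ (z + (d : ZMod n)).val ↔ d ∣ z.val := by
  rw [ZMod.val_add, ZMod.val_natCast, Nat.add_mod_mod, Nat.dvd_mod_iff hd]
  exact Nat.dvd_add_self_right

/-- A character sum over a subgroup of `ℤ/nℤ` is an integer. -/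
theorem exists_int_sum_stdAddChar_dvd {d : ℕ} (hd : d ∣ n) (j : ZMod n) :
    ∃ c : ℤ, (c : ℂ) = ∑ z : ZMod n with d ∣ z.val, stdAddChar (j * z) := by
  by_cases h : stdAddChar (j * (d : ZMod n)) = (1 : ℂ)
  · refine ⟨((Finset.univ.filter fun z : ZMod n => d ∣ z.val).card : ℤ), ?_⟩
    rw [Finset.sum_congr rfl (g := fun _ => (1 : ℂ))]
    · simp
    · intro z hz
      obtain ⟨r, hr⟩ := (Finset.mem_filter.mp hz).2
      have hz' : j * z = r • (j * (d : ZMod n)) := by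
        rw [← ZMod.natCast_zmod_val z, hr]; push_cast; rw [nsmul_eq_mul]; ring
      rw [hz', AddChar.map_nsmul_eq_pow, h, one_pow]
  · refine ⟨0, ?_⟩
    -- Translation by `d` permutes the subgroup and multiplies the sum by a factor other than 1, so
    -- the sum vanishes.
    have key : stdAddChar (j * (d : ZMod n)) *
        ∑ z : ZMod n with d ∣ z.val, (stdAddChar (j * z) : ℂ) =
        ∑ z : ZMod n with d ∣ z.val, (stdAddChar (j * z) : ℂ) := by
      rw [Finset.mul_sum]
      refine Finset.sum_equiv (Equiv.addRight (d : ZMod n)) ?_ ?_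
      · intro z
        simp [dvd_val_add_natCast_iff hd]
      · intro z _
        rw [← AddChar.map_add_eq_mul, Equiv.coe_addRight, mul_add, add_comm]
    have := sub_eq_zero.mpr key
    rw [← sub_one_mul, mul_eq_zero] at this
    rcases this with h' | h'
    · exact absurd (sub_eq_zero.mp h') h
    · rw [h']; simp

/-- Ramanujan sums are integers. -/
theorem exists_int_sum_stdAddChar_gcd (j : ZMod n) (d : ℕ) (hd : d ∣ n) :
    ∃ c : ℤ, (c : ℂ) = ∑ z : ZMod n with Nat.gcd z.val n = d, stdAddChar (j * z) := by
  -- Downward induction on `d`: the sum over multiples of `d` splits by the value `e` of the gcd,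
  -- and every `e ≠ d` is a larger divisor.
  induction hk : n - d using Nat.strong_induction_on generalizing d with
  | _ k ih =>
    obtain ⟨c, hc⟩ := exists_int_sum_stdAddChar_dvd hd j
    have hsplit : ∑ z : ZMod n with d ∣ z.val, (stdAddChar (j * z) : ℂ) =
        ∑ e ∈ n.divisors with d ∣ e,
          ∑ z : ZMod n with Nat.gcd z.val n = e, stdAddChar (j * z) := by
      rw [← Finset.sum_fiberwise_of_maps_to (t := n.divisors.filter (d ∣ ·))
        (g := fun z : ZMod n => Nat.gcd z.val n)]
      · refine Finset.sum_congr rfl fun e he => Finset.sum_congr ?_ fun _ _ => rfl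
        ext z
        simp only [Finset.mem_filter, Finset.mem_univ, true_and, and_iff_right_iff_imp] at he ⊢
        rintro rfl
        exact he.2.trans (Nat.gcd_dvd_left _ _)
      · intro z hz
        simp only [Finset.mem_filter, Finset.mem_univ, true_and, Nat.mem_divisors] at hz ⊢
        exact ⟨⟨Nat.gcd_dvd_right _ _, NeZero.ne n⟩, Nat.dvd_gcd hz hd⟩
    have hmem : d ∈ n.divisors.filter (d ∣ ·) := by simp [hd, NeZero.ne n]
    have hrest : ∀ e ∈ (n.divisors.filter (d ∣ ·)).erase d, ∃ c : ℤ,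
        (c : ℂ) = ∑ z : ZMod n with Nat.gcd z.val n = e, stdAddChar (j * z) := by
      intro e he
      simp only [Finset.mem_erase, Finset.mem_filter, Nat.mem_divisors] at he
      obtain ⟨hne, ⟨hen, hn0⟩, hde⟩ := he
      have h1 : e ≤ n := Nat.le_of_dvd (Nat.pos_of_ne_zero hn0) hen
      have h2 : d ≤ e := Nat.le_of_dvd (Nat.pos_of_dvd_of_pos hen (Nat.pos_of_ne_zero hn0)) hde
      exact ih (n - e) (by omega) e hen rfl
    choose! f hf using hrest
    refine ⟨c - ∑ e ∈ (n.divisors.filter (d ∣ ·)).erase d, f e, ?_⟩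
    push_cast
    rw [hc, hsplit, ← Finset.add_sum_erase _ _ hmem, Finset.sum_congr rfl hf]
    ring

theorem exists_int_icgEigenvalue {D : Finset ℕ} (hD : ∀ d ∈ D, d ∣ n) (j : ZMod n) :
    ∃ c : ℤ, (c : ℂ) = icgEigenvalue n D j := by
  have h : ∀ d ∈ D, ∃ c : ℤ,
      (c : ℂ) = ∑ z : ZMod n with Nat.gcd z.val n = d, stdAddChar (j * z) :=
    fun d hd => exists_int_sum_stdAddChar_gcd j d (hD d hd)
  choose! f hf using h
  refine ⟨∑ d ∈ D, f d, ?_⟩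
  push_cast
  rw [Finset.sum_congr rfl hf, icgEigenvalue]
  simp_rw [Finset.sum_filter]
  rw [Finset.sum_comm]
  refine Finset.sum_congr rfl fun z _ => ?_
  rw [Finset.sum_ite_eq, gcdIndicator]
  split_ifs <;> simp

end Integrality

/-! ### Unitarity of the time evolution and its action on eigenvectors -/

section MatrixExponential

variable {V : Type*} [Fintype V] [DecidableEq V]

theorem Matrix.exp_mulVec_of_mulVec_eq_smul {M : Matrix V V ℂ} {v : V → ℂ} {μ : ℂ}
    (h : M.mulVec v = μ • v) : (NormedSpace.exp M).mulVec v = Complex.exp μ • v := by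
  let _ : NormedRing (Matrix V V ℂ) := Matrix.linftyOpNormedRing
  let _ : NormedAlgebra ℂ (Matrix V V ℂ) := Matrix.linftyOpNormedAlgebra
  have hpow : ∀ k : ℕ, (M ^ k).mulVec v = μ ^ k • v := by
    intro k
    induction k with
    | zero => simp
    | succ k ih => rw [pow_succ, ← Matrix.mulVec_mulVec, h, Matrix.mulVec_smul, ih, smul_smul,
        pow_succ, mul_comm]
  have h1 := NormedSpace.exp_series_hasSum_exp' (𝕂 := ℂ) M
  have h2 := NormedSpace.exp_series_hasSum_exp' (𝕂 := ℂ) μ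
  let T : Matrix V V ℂ →+ (V → ℂ) :=
    { toFun := fun A => A.mulVec v, map_zero' := by simp, map_add' := fun A B => Matrix.add_mulVec A B v }
  have hT : Continuous T := by
    change Continuous fun A : Matrix V V ℂ => A.mulVec v
    fun_prop
  have h3 := h1.map T hT
  have h4 := h2.smul_const v
  rw [← Complex.exp_eq_exp_ℂ] at h4
  refine h3.unique ?_
  convert h4 using 2 with k
  change ((_ : ℂ) • M ^ k).mulVec v = _
  rw [Matrix.smul_mulVec, hpow, smul_smul, smul_eq_mul]

variable (G : SimpleGraph V) [DecidableRel G.Adj]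

theorem timeEvolution_mul_conjTranspose (t : ℝ) :
    timeEvolution G t * (timeEvolution G t).conjTranspose = 1 := by
  have h : ((Complex.I * (t : ℂ)) • G.adjMatrix ℂ).conjTranspose =
      -((Complex.I * (t : ℂ)) • G.adjMatrix ℂ) := by
    ext a b
    simp [Matrix.conjTranspose_apply, SimpleGraph.adjMatrix_apply, G.adj_comm b a]
    split_ifs <;> simp
  rw [timeEvolution, ← Matrix.exp_conjTranspose, h,
    ← Matrix.exp_add_of_commute _ _
      (Commute.refl ((Complex.I * (t : ℂ)) • G.adjMatrix ℂ)).neg_right, add_neg_cancel,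
    NormedSpace.exp_zero]

/-- Rows of a unitary matrix have norm 1, so an entry of modulus 1 exhausts its row. -/
theorem timeEvolution_apply_eq_zero {t : ℝ} {a b : V} (h : ‖timeEvolution G t a b‖ = 1)
    {c : V} (hc : c ≠ b) : timeEvolution G t a c = 0 := by
  have h1 := congrFun (congrFun (timeEvolution_mul_conjTranspose G t) a) a
  rw [Matrix.mul_apply, Matrix.one_apply_eq] at h1
  simp only [Matrix.conjTranspose_apply, RCLike.star_def, Complex.mul_conj'] at h1
  have h2 : ∑ x, ‖timeEvolution G t a x‖ ^ 2 = 1 := by exact_mod_cast h1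
  rw [← Finset.add_sum_erase _ _ (Finset.mem_univ b), h] at h2
  have h3 : ∑ x ∈ Finset.univ.erase b, ‖timeEvolution G t a x‖ ^ 2 = 0 := by linarith
  rw [Finset.sum_eq_zero_iff_of_nonneg fun _ _ => by positivity] at h3
  simpa using h3 c (by simp [hc])

theorem exp_mul_eq_of_norm_timeEvolution_eq_one {t : ℝ} {a b : V}
    (h : ‖timeEvolution G t a b‖ = 1) {v : V → ℂ} {μ : ℂ}
    (hv : (G.adjMatrix ℂ).mulVec v = μ • v) :
    Complex.exp (Complex.I * t * μ) * v a = timeEvolution G t a b * v b := by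
  have h1 : ((Complex.I * (t : ℂ)) • G.adjMatrix ℂ).mulVec v = (Complex.I * t * μ) • v := by
    rw [Matrix.smul_mulVec, hv, smul_smul]
  have h2 := congrFun (Matrix.exp_mulVec_of_mulVec_eq_smul h1) a
  rw [Pi.smul_apply, smul_eq_mul] at h2
  rw [← h2]
  change ∑ x, timeEvolution G t a x * v x = _
  exact Finset.sum_eq_single b (fun c _ hc => by rw [timeEvolution_apply_eq_zero G h hc, zero_mul])
    (by simp)

end MatrixExponential

/-! ### Characters as eigenvectors, and the 2-adic form of the phase condition -/

section Spectrum

variable {n : ℕ} [NeZero n] {D : Finset ℕ}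

theorem ICG_adjMatrix_apply (hD : D ⊆ n.properDivisors) (a b : ZMod n) :
    (ICG n D).adjMatrix ℂ a b = gcdIndicator n D (b - a) := by
  rw [← (SimpleGraph.isSymm_adjMatrix (ICG n D)).apply, SimpleGraph.adjMatrix_apply, gcdIndicator]
  change (if b ≠ a ∧ Nat.gcd (b - a).val n ∈ D then (1 : ℂ) else 0) = _
  have h : (b ≠ a ∧ Nat.gcd (b - a).val n ∈ D) ↔ Nat.gcd (b - a).val n ∈ D := by
    refine and_iff_right_of_imp ?_
    rintro h rfl
    rw [sub_self, ZMod.val_zero, Nat.gcd_zero_left] at h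
    exact absurd (Nat.mem_properDivisors.mp (hD h)).2 (lt_irrefl _)
  simp only [h]
  split_ifs <;> simp

theorem ICG_adjMatrix_mulVec (hD : D ⊆ n.properDivisors) (j : ZMod n) :
    ((ICG n D).adjMatrix ℂ).mulVec (fun x => stdAddChar (j * x)) =
      icgEigenvalue n D j • fun x => (stdAddChar (j * x) : ℂ) := by
  ext a
  change ∑ b, (ICG n D).adjMatrix ℂ a b * stdAddChar (j * b) = _
  rw [Pi.smul_apply, smul_eq_mul, icgEigenvalue, Finset.sum_mul]
  refine (Fintype.sum_equiv (Equiv.addRight a) _ _ fun z => ?_).symm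
  rw [ICG_adjMatrix_apply hD, Equiv.coe_addRight, add_sub_cancel_right, mul_add,
    AddChar.map_add_eq_mul, mul_assoc]

theorem gcdIndicator_neg (hD : D ⊆ n.properDivisors) (z : ZMod n) :
    gcdIndicator n D (-z) = gcdIndicator n D z := by
  have h1 := ICG_adjMatrix_apply hD z 0
  have h2 := ICG_adjMatrix_apply hD 0 z
  rw [← (SimpleGraph.isSymm_adjMatrix (ICG n D)).apply, h2, zero_sub, sub_zero] at h1
  exact_mod_cast h1.symm

theorem icgEigenvalue_neg (hD : D ⊆ n.properDivisors) (j : ZMod n) :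
    icgEigenvalue n D (-j) = icgEigenvalue n D j := by
  refine Fintype.sum_equiv (Equiv.neg _) _ _ fun z => ?_
  rw [Equiv.neg_apply, gcdIndicator_neg hD, mul_neg, neg_mul]

/-- Perfect state transfer forces the phases `exp (i t λ_j)` to alternate. -/
theorem HasPST.exists_phase (hD : D ⊆ n.properDivisors) (h : HasPST (ICG n D)) :
    2 ∣ n ∧ ∃ (t : ℝ) (c : ℂ), c ≠ 0 ∧
      ∀ j : ℕ, Complex.exp (Complex.I * t * icgEigenvalue n D j) = c * (-1) ^ j := by
  obtain ⟨a, b, hab, t, -, hU⟩ := h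
  have hj : ∀ j : ZMod n, Complex.exp (Complex.I * t * icgEigenvalue n D j) =
      timeEvolution (ICG n D) t a b * stdAddChar (j * (b - a)) := by
    intro j
    have h1 := exp_mul_eq_of_norm_timeEvolution_eq_one _ hU (ICG_adjMatrix_mulVec hD j)
    have h2 : (stdAddChar (j * b) : ℂ) = stdAddChar (j * (b - a)) * stdAddChar (j * a) := by
      rw [← AddChar.map_add_eq_mul]; congr 1; ring
    rw [h2, ← mul_assoc] at h1
    exact mul_right_cancel₀ (AddChar.val_isUnit _ _).ne_zero h1
  have hU0 : timeEvolution (ICG n D) t a b ≠ 0 := by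
    intro h0; rw [h0, norm_zero] at hU; exact zero_ne_one hU
  -- Comparing the indices `1` and `-1`, which share an eigenvalue, shows that `b - a` has order
  -- two.
  have hs : (stdAddChar (b - a) : ℂ) = stdAddChar (-(b - a)) := by
    have h1 := hj 1
    have h2 := hj (-1)
    rw [icgEigenvalue_neg hD, h1, one_mul, neg_one_mul] at h2
    exact mul_left_cancel₀ hU0 h2
  have hd : b - a ≠ 0 := sub_ne_zero.mpr hab.symm
  have h2d : (b - a) + (b - a) = 0 := by
    nth_rewrite 2 [ZMod.injective_stdAddChar hs]
    exact add_neg_cancel _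
  have hm1 : (stdAddChar (b - a) : ℂ) = -1 := by
    have h1 : (stdAddChar (b - a) : ℂ) * stdAddChar (b - a) = 1 := by
      rw [← AddChar.map_add_eq_mul, h2d, AddChar.map_zero_eq_one]
    rcases mul_self_eq_one_iff.mp h1 with h1 | h1
    · rw [← AddChar.map_zero_eq_one (stdAddChar (N := n))] at h1
      exact absurd (ZMod.injective_stdAddChar h1) hd
    · exact h1
  refine ⟨?_, t, _, hU0, fun j => ?_⟩
  · by_contra h2
    have hu : IsUnit ((2 : ℕ) : ZMod n) :=
      (ZMod.isUnit_iff_coprime 2 n).mpr ((Nat.prime_two.coprime_iff_not_dvd).mpr h2)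
    apply hd
    rw [← two_mul] at h2d
    exact (hu.mul_right_eq_zero).mp (by exact_mod_cast h2d)
  · rw [hj, ← nsmul_eq_mul, AddChar.map_nsmul_eq_pow, hm1]

/-- If the phases `exp (i t l_j)` of an integer sequence alternate in sign, then the
differences between terms of equal parity are more divisible by two than `l 1 - l 0`. -/
theorem exists_two_pow_dvd_sub_of_phase {l : ℕ → ℤ} {t : ℝ} {c : ℂ} (hc : c ≠ 0)
    (h : ∀ j, Complex.exp (Complex.I * t * l j) = c * (-1) ^ j) :
    ∃ e : ℕ, ¬ (2 : ℤ) ^ e ∣ l 1 - l 0 ∧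
      ∀ i j, i % 2 = j % 2 → (2 : ℤ) ^ e ∣ l i - l j := by
  have hquot : ∀ i j, Complex.exp (Complex.I * t * (l i - l j)) = (-1) ^ i / (-1) ^ j := by
    intro i j
    rw [mul_sub, Complex.exp_sub, h, h, mul_div_mul_left _ _ hc]
  obtain ⟨q, hq⟩ : ∃ q : ℤ, (t : ℂ) * (l 1 - l 0) = Real.pi * (2 * q + 1) := by
    have h1 := hquot 1 0
    rw [pow_one, pow_zero, div_one, ← Complex.exp_pi_mul_I, Complex.exp_eq_exp_iff_exists_int] at h1
    obtain ⟨q, hq⟩ := h1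
    refine ⟨q, mul_right_cancel₀ Complex.I_ne_zero ?_⟩
    linear_combination hq
  have heven : ∀ i j, i % 2 = j % 2 → ∃ r : ℤ, (t : ℂ) * (l i - l j) = Real.pi * (2 * r) := by
    intro i j hij
    have h1 := hquot i j
    rw [neg_one_pow_eq_pow_mod_two, hij, ← neg_one_pow_eq_pow_mod_two,
      div_self (pow_ne_zero _ (by norm_num)), Complex.exp_eq_one_iff] at h1
    obtain ⟨q, hq⟩ := h1
    refine ⟨q, mul_right_cancel₀ Complex.I_ne_zero ?_⟩
    linear_combination hq
  have hp : l 1 - l 0 ≠ 0 := by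
    intro h0
    have h0' : ((l 1 : ℂ) - l 0) = 0 := by exact_mod_cast h0
    rw [h0', mul_zero, eq_comm, mul_eq_zero] at hq
    rcases hq with hq | hq
    · simp [Real.pi_ne_zero] at hq
    · have : 2 * q + 1 = 0 := by exact_mod_cast hq
      omega
  have hfin : FiniteMultiplicity (2 : ℤ) (l 1 - l 0) :=
    Int.finiteMultiplicity_iff.mpr ⟨by decide, hp⟩
  -- `e` exceeds the 2-adic valuation of `l 1 - l 0` by one; the extra factor 2 comes from odd
  -- versus even multiples of `π`.
  refine ⟨multiplicity 2 (l 1 - l 0) + 1, hfin.not_pow_dvd_of_multiplicity_lt (Nat.lt_succ_self _), ?_⟩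
  intro i j hij
  obtain ⟨r, hr⟩ := heven i j hij
  -- Eliminating `t` from the two phase equations leaves an identity of integers.
  have hcross : (2 * q + 1) * (l i - l j) = 2 * r * (l 1 - l 0) := by
    have hpi : (Real.pi : ℂ) ≠ 0 := by simp [Real.pi_ne_zero]
    have : ((2 * q + 1) * (l i - l j) : ℂ) = 2 * r * (l 1 - l 0) := by
      have ht : (t : ℂ) ≠ 0 := by
        intro ht
        rw [ht, zero_mul, eq_comm, mul_eq_zero] at hq
        rcases hq with hq | hq
        · exact hpi hq
        · have : 2 * q + 1 = 0 := by exact_mod_cast hq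
          omega
      refine mul_left_cancel₀ (mul_ne_zero hpi ht) ?_
      linear_combination (t : ℂ) * (l 1 - l 0) * hr - (t : ℂ) * (l i - l j) * hq
    exact_mod_cast this
  have hdvd : (2 : ℤ) ^ (multiplicity 2 (l 1 - l 0) + 1) ∣ (2 * q + 1) * (l i - l j) := by
    rw [hcross, pow_succ', mul_assoc]
    exact mul_dvd_mul_left _ ((pow_multiplicity_dvd _ _).mul_left _)
  refine IsCoprime.dvd_of_dvd_mul_left (IsCoprime.pow_left ?_) hdvd
  exact ⟨-q, 1, by ring⟩

end Spectrum

/-! ### Fourier inversion on cosets and divisibility by powers of two -/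

section Fibre

variable {n : ℕ} [NeZero n] {D : Finset ℕ}

theorem isIntegral_stdAddChar (z : ZMod n) : IsIntegral ℤ (stdAddChar z : ℂ) := by
  refine IsIntegral.of_pow (NeZero.pos n) ?_
  rw [← AddChar.map_nsmul_eq_pow, nsmul_eq_mul, ZMod.natCast_self, zero_mul,
    AddChar.map_zero_eq_one]
  exact isIntegral_one

theorem sum_range_stdAddChar {M N : ℕ} (hn : n = M * N) (u : ZMod n) :
    ∑ y ∈ Finset.range N, (stdAddChar ((M : ZMod n) * (y : ZMod n) * u) : ℂ) =
      if (M : ZMod n) * u = 0 then (N : ℂ) else 0 := by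
  have hpow : ∀ y : ℕ, (stdAddChar ((M : ZMod n) * (y : ZMod n) * u) : ℂ) =
      stdAddChar ((M : ZMod n) * u) ^ y := by
    intro y
    rw [← AddChar.map_nsmul_eq_pow, nsmul_eq_mul]
    congr 1; ring
  split_ifs with h
  · simp [hpow, h]
  · have h1 : (stdAddChar ((M : ZMod n) * u) : ℂ) ≠ 1 := by
      rw [← AddChar.map_zero_eq_one (stdAddChar (N := n))]
      exact fun h' => h (ZMod.injective_stdAddChar h')
    rw [Finset.sum_congr rfl fun y _ => hpow y, geom_sum_eq h1, ← hpow,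
      ← Nat.cast_mul, ← hn, ZMod.natCast_self, zero_mul, AddChar.map_zero_eq_one, sub_self, zero_div]

/-- Fourier inversion along a coset of the subgroup generated by `M`. -/
theorem sum_range_icgEigenvalue {M N : ℕ} (hn : n = M * N) (j x : ZMod n) :
    ∑ y ∈ Finset.range N, icgEigenvalue n D (j + (M : ZMod n) * (y : ZMod n)) *
        stdAddChar (-((j + (M : ZMod n) * (y : ZMod n)) * x)) =
      N * ∑ w : ZMod n with (M : ZMod n) * w = 0, (gcdIndicator n D (x + w) : ℂ) * stdAddChar (j * w) := by
  have h1 : ∀ y : ℕ, icgEigenvalue n D (j + (M : ZMod n) * (y : ZMod n)) *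
        stdAddChar (-((j + (M : ZMod n) * (y : ZMod n)) * x)) =
      ∑ w : ZMod n, (gcdIndicator n D (x + w) : ℂ) * stdAddChar (j * w) *
        stdAddChar ((M : ZMod n) * (y : ZMod n) * w) := by
    intro y
    rw [icgEigenvalue, Finset.sum_mul]
    refine (Fintype.sum_equiv (Equiv.addLeft x) _ _ fun w => ?_).symm
    refine (mul_assoc _ _ _).trans (Eq.trans ?_ (mul_assoc _ _ _).symm)
    rw [← AddChar.map_add_eq_mul, ← AddChar.map_add_eq_mul, Equiv.coe_addLeft]
    congr 2; ring
  rw [Finset.sum_congr rfl fun y _ => h1 y, Finset.sum_comm, Finset.mul_sum, Finset.sum_filter]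
  refine Finset.sum_congr rfl fun w _ => ?_
  rw [← Finset.mul_sum, sum_range_stdAddChar hn]
  split_ifs <;> ring

theorem exists_int_eq_of_isIntegral {a b : ℤ} (hb : b ≠ 0) {α : ℂ} (hα : IsIntegral ℤ α)
    (h : (a : ℂ) = b * α) : b ∣ a := by
  have hb' : (b : ℂ) ≠ 0 := by exact_mod_cast hb
  have h1 : α = algebraMap ℚ ℂ (a / b) := by
    rw [eq_ratCast]; push_cast; rw [h, mul_div_cancel_left₀ _ hb']
  rw [h1, isIntegral_algebraMap_iff (algebraMap ℚ ℂ).injective,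
    IsIntegrallyClosed.isIntegral_iff] at hα
  obtain ⟨c, hc⟩ := hα
  refine ⟨c, ?_⟩
  rw [eq_div_iff (by exact_mod_cast hb)] at hc
  have : c * b = a := by rw [eq_intCast] at hc; exact_mod_cast hc
  rw [← this, mul_comm]

variable {l : ℕ → ℤ} (hl : ∀ j : ℕ, (l j : ℂ) = icgEigenvalue n D j)

include hl in
-- The constant part `C` of the eigenvalues meets a character sum that vanishes because `M * x ≠ 0`.
-- Hence `N * τ` is `2^e` times an algebraic integer, and `N` is odd.
theorem two_pow_dvd_fibre_sum {M N e : ℕ} (hn : n = M * N) (hN : Odd N) {j : ℕ} {C : ℤ}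
    (hC : ∀ y : ℕ, (2 : ℤ) ^ e ∣ l (j + M * y) - C) {x : ZMod n} (hx : (M : ZMod n) * x ≠ 0)
    {τ : ℤ} (hτ : (τ : ℂ) = ∑ w : ZMod n with (M : ZMod n) * w = 0,
      (gcdIndicator n D (x + w) : ℂ) * stdAddChar ((j : ZMod n) * w)) :
    (2 : ℤ) ^ e ∣ τ := by
  choose μ hμ using hC
  have h1 := sum_range_icgEigenvalue (D := D) hn j x
  rw [← hτ] at h1
  have h2 : ∑ y ∈ Finset.range N, (stdAddChar (-(((j : ZMod n) + (M : ZMod n) * (y : ZMod n)) * x)) : ℂ) = 0 := by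
    have h3 : ∀ y : ℕ, (stdAddChar (-(((j : ZMod n) + (M : ZMod n) * (y : ZMod n)) * x)) : ℂ) =
        stdAddChar (-((j : ZMod n) * x)) * stdAddChar ((M : ZMod n) * (y : ZMod n) * (-x)) := by
      intro y
      rw [← AddChar.map_add_eq_mul]
      congr 1; ring
    rw [Finset.sum_congr rfl fun y _ => h3 y, ← Finset.mul_sum, sum_range_stdAddChar hn,
      if_neg (by rwa [mul_neg, neg_eq_zero]), mul_zero]
  have h4 : ((N * τ : ℤ) : ℂ) = ((2 ^ e : ℤ) : ℂ) *
      ∑ y ∈ Finset.range N, (μ y : ℂ) * stdAddChar (-(((j : ZMod n) + (M : ZMod n) * (y : ZMod n)) * x)) := by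
    push_cast
    rw [← h1, Finset.mul_sum, ← sub_eq_zero, ← Finset.sum_sub_distrib]
    rw [← mul_eq_zero_of_right (C : ℂ) h2, Finset.mul_sum]
    refine Finset.sum_congr rfl fun y _ => ?_
    have h5 : (l (j + M * y) : ℂ) = C + 2 ^ e * μ y := by
      have := hμ y
      rw [sub_eq_iff_eq_add] at this
      rw [this]; push_cast; ring
    rw [hl] at h5
    push_cast at h5
    rw [h5]; ring
  have h6 := exists_int_eq_of_isIntegral (by positivity)
    (IsIntegral.sum _ fun y _ => (isIntegral_algebraMap (x := μ y)).mul
      (isIntegral_stdAddChar (-(((j : ZMod n) + (M : ZMod n) * (y : ZMod n)) * x)))) h4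
  refine IsCoprime.dvd_of_dvd_mul_left (IsCoprime.pow_left ?_) h6
  exact Nat.isCoprime_iff_coprime.mpr (Nat.coprime_two_left.mpr hN)

include hl in
-- At `x = 0` the characters are all 1, so `N * τ` is a sum of `N` eigenvalues congruent to `C`.
theorem two_pow_dvd_fibre_sum_zero {M N e : ℕ} (hn : n = M * N) (hN : Odd N) {j : ℕ} {C : ℤ}
    (hC : ∀ y : ℕ, (2 : ℤ) ^ e ∣ l (j + M * y) - C)
    {τ : ℤ} (hτ : (τ : ℂ) = ∑ w : ZMod n with (M : ZMod n) * w = 0,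
      (gcdIndicator n D w : ℂ) * stdAddChar ((j : ZMod n) * w)) :
    (2 : ℤ) ^ e ∣ τ - C := by
  have h1 := sum_range_icgEigenvalue (D := D) hn j 0
  simp only [zero_add, ← hτ, mul_zero, neg_zero, AddChar.map_zero_eq_one, mul_one] at h1
  have h2 : ∑ y ∈ Finset.range N, l (j + M * y) = N * τ := by
    have : ((∑ y ∈ Finset.range N, l (j + M * y) : ℤ) : ℂ) = N * τ := by
      rw [← h1]; push_cast
      refine Finset.sum_congr rfl fun y _ => ?_
      rw [hl]; push_cast; rfl
    exact_mod_cast this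
  have h3 : (2 : ℤ) ^ e ∣ N * (τ - C) := by
    rw [mul_sub, ← h2]
    have : (N : ℤ) * C = ∑ y ∈ Finset.range N, C := by simp
    rw [this, ← Finset.sum_sub_distrib]
    exact Finset.dvd_sum fun y _ => hC y
  refine IsCoprime.dvd_of_dvd_mul_left (IsCoprime.pow_left ?_) h3
  exact Nat.isCoprime_iff_coprime.mpr (Nat.coprime_two_left.mpr hN)

end Fibre

/-! ### Cancellation in sums over the 2-primary torsion -/

section Cancellation

theorem Nat.dvd_two_pow_mul_of_not_two_pow_dvd {e k r N : ℕ} (h : e ∣ 2 ^ k * N)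
    (he : ¬ 2 ^ r ∣ e) : e ∣ 2 ^ r * N := by
  have he0 : e ≠ 0 := by rintro rfl; exact he (dvd_zero _)
  obtain ⟨a, u, hu, rfl⟩ := Nat.exists_eq_two_pow_mul_odd he0
  have har : a ≤ r := by
    by_contra hlt
    exact he ((pow_dvd_pow 2 (by omega)).mul_right u)
  have h1 : u ∣ N := Nat.Coprime.dvd_of_dvd_mul_left
    (Nat.Coprime.pow_right k (Nat.coprime_two_right.mpr hu)) ((Dvd.intro_left _ rfl).trans h)
  exact mul_dvd_mul (pow_dvd_pow 2 har) h1

/-- Neither gcd is divisible by `2^r`, so both divide the shift `2^r * N`. -/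
theorem Nat.gcd_add_eq_gcd_of_not_two_pow_dvd {a k r N : ℕ} (ha : ¬ 2 ^ r ∣ a) :
    Nat.gcd (a + 2 ^ r * N) (2 ^ k * N) = Nat.gcd a (2 ^ k * N) := by
  have ha' : ¬ 2 ^ r ∣ a + 2 ^ r * N := by
    rwa [Nat.dvd_add_left (Dvd.intro _ rfl)]
  have h1 : Nat.gcd (a + 2 ^ r * N) (2 ^ k * N) ∣ 2 ^ r * N :=
    Nat.dvd_two_pow_mul_of_not_two_pow_dvd (Nat.gcd_dvd_right _ _)
      fun h => ha' (h.trans (Nat.gcd_dvd_left _ _))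
  have h2 : Nat.gcd a (2 ^ k * N) ∣ 2 ^ r * N :=
    Nat.dvd_two_pow_mul_of_not_two_pow_dvd (Nat.gcd_dvd_right _ _)
      fun h => ha (h.trans (Nat.gcd_dvd_left _ _))
  apply Nat.dvd_antisymm
  · exact Nat.dvd_gcd ((Nat.dvd_add_left h1).mp (Nat.gcd_dvd_left _ _)) (Nat.gcd_dvd_right _ _)
  · exact Nat.dvd_gcd (Dvd.dvd.add (Nat.gcd_dvd_left _ _) h2) (Nat.gcd_dvd_right _ _)

variable {n : ℕ} [NeZero n] {D : Finset ℕ}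

theorem natCast_mul_eq_zero_iff_dvd_val (M : ℕ) (w : ZMod n) :
    (M : ZMod n) * w = 0 ↔ n ∣ M * w.val := by
  rw [← ZMod.natCast_eq_zero_iff, Nat.cast_mul, ZMod.natCast_zmod_val]

theorem sum_filter_mul_eq_zero {m q : ℕ} (hn : n = m * q) (f : ZMod n → ℂ) :
    ∑ w : ZMod n with (m : ZMod n) * w = 0, f w = ∑ r ∈ Finset.range m, f ((r * q : ℕ) : ZMod n) := by
  have hq : 0 < q := Nat.pos_of_ne_zero fun h => NeZero.ne n (by rw [hn, h, mul_zero])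
  have hm : 0 < m := Nat.pos_of_ne_zero fun h => NeZero.ne n (by rw [hn, h, zero_mul])
  have hlt : ∀ r ∈ Finset.range m, r * q < n := fun r hr => by
    rw [hn]; exact Nat.mul_lt_mul_of_pos_right (Finset.mem_range.mp hr) hq
  symm
  refine Finset.sum_bij (fun r _ => ((r * q : ℕ) : ZMod n)) ?_ ?_ ?_ fun _ _ => rfl
  · intro r _
    simp only [Finset.mem_filter, Finset.mem_univ, true_and]
    rw [← Nat.cast_mul, ZMod.natCast_eq_zero_iff]
    exact ⟨r, by rw [hn]; ring⟩
  · intro r hr s hs h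
    have := congrArg ZMod.val h
    rw [ZMod.val_cast_of_lt (hlt r hr), ZMod.val_cast_of_lt (hlt s hs)] at this
    exact Nat.eq_of_mul_eq_mul_right hq this
  · intro w hw
    simp only [Finset.mem_filter, Finset.mem_univ, true_and] at hw
    rw [natCast_mul_eq_zero_iff_dvd_val] at hw
    have hqw : q ∣ w.val := by
      exact Nat.dvd_of_mul_dvd_mul_left hm (hn.symm.dvd.trans hw)
    obtain ⟨r, hr⟩ := hqw
    refine ⟨r, ?_, ?_⟩
    · have := ZMod.val_lt w
      rw [hr, hn] at this
      rw [Finset.mem_range]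
      exact Nat.lt_of_mul_lt_mul_left (by rwa [mul_comm m q] at this)
    · rw [mul_comm, ← hr, ZMod.natCast_zmod_val]

theorem stdAddChar_half {h : ℕ} (hn : n = 2 * h) : (stdAddChar (h : ZMod n) : ℂ) = -1 := by
  have hpos : 0 < h := Nat.pos_of_ne_zero fun h0 => NeZero.ne n (by rw [hn, h0, mul_zero])
  have h1 : (stdAddChar (h : ZMod n) : ℂ) * stdAddChar (h : ZMod n) = 1 := by
    rw [← AddChar.map_add_eq_mul, ← two_mul]
    have : (2 : ZMod n) * h = ((2 * h : ℕ) : ZMod n) := by push_cast; rfl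
    rw [this, ← hn, ZMod.natCast_self, AddChar.map_zero_eq_one]
  rcases mul_self_eq_one_iff.mp h1 with h2 | h2
  · rw [← AddChar.map_zero_eq_one (stdAddChar (N := n))] at h2
    have h3 := ZMod.injective_stdAddChar h2
    rw [ZMod.natCast_eq_zero_iff] at h3
    have := Nat.le_of_dvd hpos h3
    omega
  · exact h2

/-- In a sum over the `2`-primary part of `ℤ/nℤ`, all terms outside the `2 ^ (s + 1)`-torsion
cancel in pairs. -/
theorem sum_two_primary_eq {k s N q X : ℕ} (hn : n = 2 ^ k * N) (hN : Odd N) (hs : s + 1 ≤ k)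
    (hq : n = 2 ^ (s + 1) * q) (hX : 2 ^ k ∣ X) :
    ∑ w : ZMod n with ((2 ^ k : ℕ) : ZMod n) * w = 0,
        (gcdIndicator n D (X + w) : ℂ) * stdAddChar (((2 ^ s : ℕ) : ZMod n) * w) =
      ((∑ r ∈ Finset.range (2 ^ (s + 1)), (-1) ^ r * gcdIndicator n D (X + r * q : ℕ) : ℤ) : ℂ) := by
  have hqN : q = 2 ^ (k - (s + 1)) * N := by
    have h1 : 2 ^ (s + 1) * q = 2 ^ (s + 1) * (2 ^ (k - (s + 1)) * N) := by
      rw [← hq, hn, ← mul_assoc, ← pow_add]; congr 2; omega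
    exact Nat.eq_of_mul_eq_mul_left (by positivity) h1
  have hhalf : (stdAddChar (((2 ^ s : ℕ) : ZMod n) * (q : ZMod n)) : ℂ) = -1 := by
    rw [← Nat.cast_mul]
    exact stdAddChar_half (by rw [hq]; ring)
  set f : ZMod n → ℂ := fun w =>
    (gcdIndicator n D (X + w) : ℂ) * stdAddChar (((2 ^ s : ℕ) : ZMod n) * w) with hf
  have htors : ∑ w : ZMod n with ((2 ^ (s + 1) : ℕ) : ZMod n) * w = 0, f w =
      ((∑ r ∈ Finset.range (2 ^ (s + 1)),
        (-1) ^ r * gcdIndicator n D (X + r * q : ℕ) : ℤ) : ℂ) := by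
    rw [sum_filter_mul_eq_zero hq]
    push_cast
    refine Finset.sum_congr rfl fun r _ => ?_
    have h1 : ((2 : ZMod n) ^ s * (r * q)) = r • (((2 ^ s : ℕ) : ZMod n) * (q : ZMod n)) := by
      rw [nsmul_eq_mul]; push_cast; ring
    simp only [hf]
    push_cast
    rw [h1, AddChar.map_nsmul_eq_pow, hhalf, mul_comm]
  rw [← htors, ← sub_eq_zero]
  have hsub : ∀ w : ZMod n, ((2 ^ (s + 1) : ℕ) : ZMod n) * w = 0 →
      ((2 ^ k : ℕ) : ZMod n) * w = 0 := by
    intro w hw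
    rw [← Nat.sub_add_cancel hs, pow_add, Nat.cast_mul, mul_assoc, hw, mul_zero]
  have hdiff : ∑ w : ZMod n with ((2 ^ k : ℕ) : ZMod n) * w = 0, f w -
      ∑ w : ZMod n with ((2 ^ (s + 1) : ℕ) : ZMod n) * w = 0, f w =
      ∑ w : ZMod n with ((2 ^ k : ℕ) : ZMod n) * w = 0 ∧
        ¬ ((2 ^ (s + 1) : ℕ) : ZMod n) * w = 0, f w := by
    simp only [Finset.sum_filter]
    rw [← Finset.sum_sub_distrib]
    refine Finset.sum_congr rfl fun w _ => ?_
    by_cases h1 : ((2 ^ (s + 1) : ℕ) : ZMod n) * w = 0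
    · simp only [h1, hsub w h1]; simp
    · by_cases h2 : ((2 ^ k : ℕ) : ZMod n) * w = 0 <;> simp only [h1, h2] <;> simp
  rw [hdiff]
  have hzero : ((2 ^ (s + 1) : ℕ) : ZMod n) * (q : ZMod n) = 0 := by
    rw [← Nat.cast_mul, ← hq, ZMod.natCast_self]
  -- The shift by `q` keeps the indicator and flips the sign of the character, so the remaining sum
  -- is its own negative.
  refine self_eq_neg.mp ?_
  rw [← Finset.sum_neg_distrib]
  refine Finset.sum_equiv (Equiv.addRight (q : ZMod n)) ?_ ?_
  · intro w
    simp only [Finset.mem_filter, Finset.mem_univ, true_and, Equiv.coe_addRight, mul_add, hzero,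
      hsub _ hzero, add_zero]
  · intro w hw
    simp only [Finset.mem_filter, Finset.mem_univ, true_and] at hw
    obtain ⟨h1, h2⟩ := hw
    -- Otherwise `q = 2^(k-(s+1)) * N` divides `w`, which puts `w` in the excluded torsion.
    have hnot : ¬ 2 ^ (k - (s + 1)) ∣ X + w.val := by
      intro h3
      have h4 : 2 ^ (k - (s + 1)) ∣ w.val :=
        (Nat.dvd_add_right ((pow_dvd_pow 2 (by omega)).trans hX)).mp h3
      rw [natCast_mul_eq_zero_iff_dvd_val] at h1 h2
      have h5 : N ∣ w.val := by
        refine Nat.dvd_of_mul_dvd_mul_left (k := 2 ^ k) (by positivity) ?_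
        rwa [← hn]
      have h6 : q ∣ w.val := hqN ▸ Nat.Coprime.mul_dvd_of_dvd_of_dvd
        (Nat.Coprime.pow_left _ (Nat.coprime_two_left.mpr hN)) h4 h5
      exact h2 (hq.dvd.trans (mul_dvd_mul_left _ h6))
    have h5 : gcdIndicator n D (X + (w + q)) = gcdIndicator n D (X + w) := by
      have h6 : (X + w : ZMod n) = ((X + w.val : ℕ) : ZMod n) := by
        rw [Nat.cast_add, ZMod.natCast_zmod_val]
      rw [← add_assoc, h6, ← Nat.cast_add, gcdIndicator_natCast, gcdIndicator_natCast]
      have h7 := Nat.gcd_add_eq_gcd_of_not_two_pow_dvd (k := k) (N := N) hnot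
      rw [← hqN, ← hn] at h7
      rw [h7]
    simp only [hf, Equiv.coe_addRight]
    rw [h5, mul_add, AddChar.map_add_eq_mul, hhalf]
    ring

end Cancellation

theorem gcdIndicator_zero {n : ℕ} {D : Finset ℕ} (hD : D ⊆ n.properDivisors) : gcdIndicator n D 0 = 0 := by
  rw [gcdIndicator, ZMod.val_zero, Nat.gcd_zero_left, if_neg]
  exact fun h => absurd (Nat.mem_properDivisors.mp (hD h)).2 (lt_irrefl _)

theorem gcdIndicator_natCast_eq_of_gcd_eq {n : ℕ} {D : Finset ℕ} {a d : ℕ} (h : Nat.gcd a n = d) :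
    gcdIndicator n D (a : ZMod n) = if d ∈ D then 1 else 0 := by
  rw [gcdIndicator_natCast, h]

/-! ### Congruences modulo four and membership in `D` -/

section Conclusion

variable {n : ℕ} [NeZero n] {D : Finset ℕ}

/-- The eigenvalues of an integral circulant graph with perfect state transfer are integers whose
differences along indices of equal parity are more divisible by two than `λ_1 - λ_0`. -/
theorem HasPST.exists_int_eigenvalues (hD : D ⊆ n.properDivisors) (h : HasPST (ICG n D)) :
    2 ∣ n ∧ ∃ (l : ℕ → ℤ) (e : ℕ), (∀ j : ℕ, (l j : ℂ) = icgEigenvalue n D j) ∧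
      ¬ (2 : ℤ) ^ e ∣ l 1 - l 0 ∧ ∀ i j, i % 2 = j % 2 → (2 : ℤ) ^ e ∣ l i - l j := by
  obtain ⟨h2, t, c, hc, hphase⟩ := h.exists_phase hD
  choose l hl using fun j : ℕ => exists_int_icgEigenvalue
    (fun d hd => (Nat.mem_properDivisors.mp (hD hd)).1) (j : ZMod n)
  obtain ⟨e, he⟩ := exists_two_pow_dvd_sub_of_phase (l := l) hc fun j => by rw [hl, hphase]
  exact ⟨h2, l, e, hl, he⟩

/-- The congruences modulo four imposed by perfect state transfer on the connection set, at a
multiple `X` of the `2`-part `2 ^ k` of `n`. -/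
theorem HasPST.four_dvd (hD : D ⊆ n.properDivisors) (h : HasPST (ICG n D)) {k N : ℕ}
    (hn : n = 2 ^ k * N) (hN : Odd N) {X : ℕ} (hX : 2 ^ k ∣ X) (hX' : ¬ n ∣ 2 ^ k * X) :
    (∀ q, n = 2 * q → (4 : ℤ) ∣ gcdIndicator n D (X : ℕ) - gcdIndicator n D (X + q : ℕ)) ∧
    (∀ q, n = 4 * q → (4 : ℤ) ∣ gcdIndicator n D (X : ℕ) - gcdIndicator n D (X + q : ℕ) +
      gcdIndicator n D (X + 2 * q : ℕ) - gcdIndicator n D (X + 3 * q : ℕ)) ∧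
    (∀ q, Odd q → n = 2 * q →
      (4 : ℤ) ∣ gcdIndicator n D (X : ℕ) + gcdIndicator n D (X + q : ℕ)) := by
  obtain ⟨h2, l, e, hl, hne, heq⟩ := h.exists_int_eigenvalues hD
  have hk : k ≠ 0 := by
    rintro rfl
    rw [hn, pow_zero, one_mul] at h2
    exact (Nat.not_even_iff_odd.mpr hN) (even_iff_two_dvd.mpr h2)
  have heven : ∀ y, (2 ^ k * y) % 2 = 0 := fun y =>
    Nat.mod_eq_zero_of_dvd ((dvd_pow_self 2 hk).mul_right y)
  have hx : ((2 ^ k : ℕ) : ZMod n) * (X : ZMod n) ≠ 0 := by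
    rwa [← Nat.cast_mul, Ne, ZMod.natCast_eq_zero_iff]
  have hC : ∀ i j, i % 2 = j % 2 → ∀ y : ℕ, (2 : ℤ) ^ e ∣ l (i + 2 ^ k * y) - l j :=
    fun i j hij y => heq _ _ (by have := heven y; omega)
  have hsum : ∀ s q, s + 1 ≤ k → n = 2 ^ (s + 1) * q → (2 : ℤ) ^ e ∣
      ∑ r ∈ Finset.range (2 ^ (s + 1)), (-1) ^ r * gcdIndicator n D (X + r * q : ℕ) :=
    fun s q hs hq => two_pow_dvd_fibre_sum hl hn hN (hC (2 ^ s) (2 ^ s) rfl) hx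
      (sum_two_primary_eq hn hN hs hq hX).symm
  have hsum0 : ∀ s q i, s + 1 ≤ k → n = 2 ^ (s + 1) * q → 2 ^ s % 2 = i % 2 → (2 : ℤ) ^ e ∣
      ∑ r ∈ Finset.range (2 ^ (s + 1)), (-1) ^ r * gcdIndicator n D (0 + r * q : ℕ) - l i := by
    intro s q i hs hq hi
    refine two_pow_dvd_fibre_sum_zero hl hn hN (hC (2 ^ s) i hi) ?_
    have := sum_two_primary_eq (D := D) (X := 0) hn hN hs hq (dvd_zero _)
    rw [← this]
    simp
  -- When `k = 1`, the index `2` gives the trivial character on the 2-torsion, hence a sum without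
  -- signs.
  have hdeg : ∀ q (x : ℕ), k = 1 → n = 2 * q →
      ((gcdIndicator n D (x : ℕ) + gcdIndicator n D (x + q : ℕ) : ℤ) : ℂ) =
      ∑ w : ZMod n with ((2 ^ k : ℕ) : ZMod n) * w = 0,
        (gcdIndicator n D ((x : ZMod n) + w) : ℂ) * stdAddChar (((2 : ℕ) : ZMod n) * w) := by
    rintro q x rfl hq
    rw [pow_one, Finset.sum_congr rfl (g := fun w => (gcdIndicator n D ((x : ZMod n) + w) : ℂ)),
      sum_filter_mul_eq_zero hq]
    · simp [Finset.sum_range_succ]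
    · intro w hw
      rw [(Finset.mem_filter.mp hw).2, AddChar.map_zero_eq_one, mul_one]
  have hk1 : ∀ q, Odd q → n = 2 * q → k = 1 := by
    intro q hq hnq
    by_contra hk1
    have h4 : 2 ^ 2 ∣ 2 * q := hnq ▸ hn ▸ (pow_dvd_pow 2 (by omega)).mul_right N
    obtain ⟨r, rfl⟩ := hq
    omega
  have he : (4 : ℤ) ∣ 2 ^ e := by
    -- Modulo `2^e`, `λ_1 ≡ -a(n/2)`, while `λ_0 ≡ a(n/2)` if `k = 1` and `λ_0 ≡ a(n/2) - 2a(n/4)`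
    -- otherwise. So `e = 1` would make `λ_1 - λ_0` even.
    have he2 : 2 ≤ e := by
      by_contra hlt
      obtain ⟨q, hq⟩ := h2
      have h1 := hsum0 0 q 1 (by omega) (by rw [hq]; rfl) rfl
      have hz := gcdIndicator_zero hD
      simp [Finset.sum_range_succ, hz] at h1
      have he1 : e = 0 ∨ e = 1 := by omega
      rcases he1 with rfl | rfl
      · simp at hne
      rw [pow_one] at h1 hne
      by_cases hk1 : k = 1
      · have h3 := hdeg q 0 hk1 hq
        simp only [Nat.cast_zero, zero_add] at h3
        have h4 := two_pow_dvd_fibre_sum_zero hl hn hN (hC 2 0 rfl) h3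
        simp [hz] at h4
        omega
      · obtain ⟨q', hq'⟩ : 2 ∣ q := by
          have h4 : 2 ^ 2 ∣ 2 * q := hq ▸ hn ▸ (pow_dvd_pow 2 (by omega)).mul_right N
          omega
        have h3 := hsum0 1 q' 0 (by omega) (by rw [hq, hq']; ring) rfl
        have h5 : (n : ZMod n) = 0 := ZMod.natCast_self n
        have h6 : gcdIndicator n D (3 * q' : ZMod n) = gcdIndicator n D (q' : ZMod n) := by
          rw [← gcdIndicator_neg hD]
          congr 1
          rw [neg_eq_iff_add_eq_zero, ← h5, hq, hq']; push_cast; ring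
        have h7 : (2 * q' : ZMod n) = q := by rw [hq']; push_cast; rfl
        simp [Finset.sum_range_succ, hz, h6, h7] at h3
        omega
    exact (show (4 : ℤ) = 2 ^ 2 by norm_num) ▸ pow_dvd_pow 2 he2
  refine ⟨fun q hq => ?_, fun q hq => ?_, fun q hq hnq => ?_⟩
  · have := he.trans (hsum 0 q (by omega) (by rw [hq]; rfl))
    simpa [Finset.sum_range_succ, sub_eq_add_neg] using this
  · have hk2 : 2 ≤ k := by
      by_contra hlt
      obtain rfl : k = 1 := by omega
      obtain ⟨r, rfl⟩ := hN
      omega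
    have := he.trans (hsum 1 q (by omega) (by rw [hq]; rfl))
    simpa [Finset.sum_range_succ, sub_eq_add_neg] using this
  · exact he.trans (two_pow_dvd_fibre_sum hl hn hN (hC 2 0 rfl) hx (hdeg q X (hk1 q hq hnq) hnq))

/-- `2 + m` is coprime to `2 * m`. With `n = 2 * m * Y`, shifting `n/m` by `n/2` thus changes its
gcd with `n` to `n/(2m)`. -/
theorem gcd_two_mul_add_mul {m : ℕ} (hm : Odd m) (Y : ℕ) :
    Nat.gcd (2 * Y + m * Y) (2 * m * Y) = Y := by
  rw [← add_mul, Nat.gcd_mul_right]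
  have h : Nat.Coprime (2 + m) (2 * m) := by
    refine Nat.Coprime.mul_right ?_ ?_
    · rw [Nat.coprime_two_right]; exact even_two.add_odd hm
    · rw [Nat.coprime_add_self_left]; exact Nat.coprime_two_left.mpr hm
  rw [h.gcd_eq_one, one_mul]

theorem gcd_four_mul_add_mul {m : ℕ} (hm : Odd m) {r : ℕ} (hr : Odd r) (W : ℕ) :
    Nat.gcd (4 * W + r * (m * W)) (4 * m * W) = W := by
  rw [← mul_assoc, ← add_mul, Nat.gcd_mul_right]
  have h4 : ∀ a, Odd a → Nat.Coprime 4 a := fun a ha =>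
    Nat.Coprime.pow_left 2 (Nat.coprime_two_left.mpr ha)
  have h : Nat.Coprime (4 + r * m) (4 * m) := by
    refine Nat.Coprime.mul_right ?_ ?_
    · exact (Nat.coprime_self_add_left.mpr ((h4 _ (hr.mul hm)).symm))
    · rw [Nat.coprime_add_mul_right_left]; exact h4 m hm
  rw [h.gcd_eq_one, one_mul]

theorem HasPST.even (hD : D ⊆ n.properDivisors) (h : HasPST (ICG n D)) : 2 ∣ n :=
  (h.exists_phase hD).1

/-- For odd `m > 1`, membership of `n / m`, `n / (2 m)` and `n / (4 m)` in the connection divisors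
of a graph with perfect state transfer is the same, where a non-integral quotient does not
belong to it. -/
theorem HasPST.mem_iff (hD : D ⊆ n.properDivisors) (h : HasPST (ICG n D)) {m : ℕ} (hm : Odd m)
    (hm1 : m ≠ 1) :
    (∀ Y, n = 2 * m * Y → (2 * Y ∈ D ↔ Y ∈ D)) ∧
    (∀ W, n = 4 * m * W → (4 * W ∈ D ↔ W ∈ D)) ∧
    (∀ Y, Odd Y → n = 2 * m * Y → 2 * Y ∉ D) := by
  obtain ⟨k, N, hN, hn⟩ := Nat.exists_eq_two_pow_mul_odd (NeZero.ne n)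
  have hX : ∀ X, n = m * X → 2 ^ k ∣ X ∧ ¬ n ∣ 2 ^ k * X := by
    intro X hX
    have hX0 : 0 < X := Nat.pos_of_ne_zero fun h0 => NeZero.ne n (by rw [hX, h0, mul_zero])
    have hcop : Nat.Coprime (2 ^ k) m := Nat.Coprime.pow_left _ (Nat.coprime_two_left.mpr hm)
    refine ⟨hcop.dvd_of_dvd_mul_left (hX ▸ ⟨N, hn⟩), fun hdvd => hm1 ?_⟩
    rw [hX] at hdvd
    exact Nat.eq_one_of_dvd_coprimes hcop (Nat.dvd_of_mul_dvd_mul_right hX0 hdvd) dvd_rfl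
  have key1 : ∀ Y, n = 2 * m * Y → (2 * Y ∈ D ↔ Y ∈ D) := by
    intro Y hY
    obtain ⟨h1, h2⟩ := hX (2 * Y) (by rw [hY]; ring)
    have h3 := (h.four_dvd hD hn hN h1 h2).1 (m * Y) (by rw [hY]; ring)
    rw [gcdIndicator_natCast_eq_of_gcd_eq (d := 2 * Y)
        (Nat.gcd_eq_left ⟨m, by rw [hY]; ring⟩),
      gcdIndicator_natCast_eq_of_gcd_eq (d := Y) (by rw [hY, gcd_two_mul_add_mul hm])] at h3
    by_cases ha : 2 * Y ∈ D <;> by_cases hb : Y ∈ D <;> simp [ha, hb] at h3 ⊢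
  refine ⟨key1, fun W hW => ?_, fun Y hYo hY => ?_⟩
  · obtain ⟨h1, h2⟩ := hX (4 * W) (by rw [hW]; ring)
    have h3 := (h.four_dvd hD hn hN h1 h2).2.1 (m * W) (by rw [hW]; ring)
    have h4 : Nat.gcd (4 * W + 2 * (m * W)) n = 2 * W := by
      have := gcd_two_mul_add_mul hm (2 * W)
      rw [hW]
      convert this using 2 <;> ring
    have h5 : Nat.gcd (4 * W + m * W) n = W := by
      have := gcd_four_mul_add_mul hm odd_one W
      rwa [one_mul, ← hW] at this
    rw [gcdIndicator_natCast_eq_of_gcd_eq (d := 4 * W)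
        (Nat.gcd_eq_left ⟨m, by rw [hW]; ring⟩),
      gcdIndicator_natCast_eq_of_gcd_eq h5, gcdIndicator_natCast_eq_of_gcd_eq h4,
      gcdIndicator_natCast_eq_of_gcd_eq (d := W)
        (by rw [hW, gcd_four_mul_add_mul hm (by decide)])] at h3
    have h6 := key1 (2 * W) (by rw [hW]; ring)
    rw [← mul_assoc] at h6
    norm_num at h6
    -- As `4W` and `2W` have equal indicators, `h3` reads `4 ∣ 2 * ([4W ∈ D] - [W ∈ D])`; modulus 2
    -- would give nothing.
    simp only [← h6] at h3
    by_cases ha : 4 * W ∈ D <;> by_cases hb : W ∈ D <;> simp [ha, hb] at h3 ⊢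
  · obtain ⟨h1, h2⟩ := hX (2 * Y) (by rw [hY]; ring)
    have h3 := (h.four_dvd hD hn hN h1 h2).2.2 (m * Y) (hm.mul hYo) (by rw [hY]; ring)
    rw [gcdIndicator_natCast_eq_of_gcd_eq (d := 2 * Y)
        (Nat.gcd_eq_left ⟨m, by rw [hY]; ring⟩),
      gcdIndicator_natCast_eq_of_gcd_eq (d := Y) (by rw [hY, gcd_two_mul_add_mul hm])] at h3
    intro ha
    by_cases hb : Y ∈ D <;> simp [ha, hb] at h3

theorem mem_divisorLevel_iff (hD : D ⊆ n.properDivisors) {i d : ℕ} :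
    d ∈ divisorLevel n D i ↔ d ∈ D ∧ ∃ m, Odd m ∧ n = 2 ^ i * m * d := by
  rw [divisorLevel, Finset.mem_filter]
  refine and_congr_right fun hd => ?_
  obtain ⟨⟨c, hc⟩, -⟩ := Nat.mem_properDivisors.mp (hD hd)
  have hn := NeZero.ne n
  have hd0 : 0 < d := Nat.pos_of_ne_zero fun h => hn (by rw [hc, h, zero_mul])
  have hc0 : c ≠ 0 := fun h => hn (by rw [hc, h, mul_zero])
  have hdiv : n / d = c := by rw [hc, Nat.mul_div_cancel_left _ hd0]
  obtain ⟨a, m, hm, rfl⟩ := Nat.exists_eq_two_pow_mul_odd hc0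
  have hval : ∀ a m, Odd m → padicValNat 2 (2 ^ a * m) = a := by
    intro a m hm
    rw [padicValNat.mul (by positivity) (by rintro rfl; simp at hm), padicValNat.prime_pow,
      padicValNat.eq_zero_of_not_dvd (by rwa [← even_iff_two_dvd, Nat.not_even_iff_odd]), add_zero]
  rw [hdiv, hval a m hm]
  constructor
  · rintro rfl
    exact ⟨m, hm, by rw [hc, mul_comm]⟩
  · rintro ⟨m', hm', h⟩
    have : 2 ^ a * m = 2 ^ i * m' := Nat.eq_of_mul_eq_mul_right hd0 (by rw [← h, hc, mul_comm])
    rw [← hval a m hm, this, hval i m' hm']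

theorem mem_divisorLevel_sdiff_iff (hD : D ⊆ n.properDivisors) {i d : ℕ} :
    d ∈ divisorLevel n D i \ {n / 2 ^ i} ↔
      d ∈ D ∧ ∃ m, Odd m ∧ m ≠ 1 ∧ n = 2 ^ i * m * d := by
  rw [Finset.mem_sdiff, mem_divisorLevel_iff hD, Finset.mem_singleton, and_assoc]
  refine and_congr_right fun hd => ?_
  have hd0 : 0 < d := Nat.pos_of_mem_properDivisors (hD hd)
  constructor
  · rintro ⟨⟨m, hm, h⟩, hne⟩
    refine ⟨m, hm, ?_, h⟩
    rintro rfl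
    apply hne
    rw [h, mul_one, Nat.mul_div_cancel_left _ (by positivity)]
  · rintro ⟨m, hm, hm1, h⟩
    refine ⟨⟨m, hm, h⟩, fun hdn => hm1 ?_⟩
    rw [h, mul_assoc, Nat.mul_div_cancel_left _ (by positivity)] at hdn
    exact Nat.eq_of_mul_eq_mul_right hd0 (by rw [one_mul, ← hdn])

/-- Nothing need be deleted at level 0: `m = 1` would mean `d = n`, which is not a proper divisor.
-/
theorem mem_divisorLevel_zero_iff (hD : D ⊆ n.properDivisors) {d : ℕ} :
    d ∈ divisorLevel n D 0 ↔ d ∈ D ∧ ∃ m, Odd m ∧ m ≠ 1 ∧ n = 2 ^ 0 * m * d := by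
  rw [mem_divisorLevel_iff hD]
  refine and_congr_right fun hd => exists_congr fun m => and_congr_right fun _ => ?_
  refine ⟨fun h => ⟨?_, h⟩, fun h => h.2⟩
  rintro rfl
  have := (Nat.mem_properDivisors.mp (hD hd)).2
  rw [h] at this
  simp at this

end Conclusion

theorem mainTheorem7 (n : ℕ) [NeZero n] (D : Finset ℕ) (hD : D ⊆ n.properDivisors)
    (hPST : HasPST (ICG n D)) :
    divisorLevel n D 1 \ {n / 2} = scaleSet 2 (divisorLevel n D 2 \ {n / 4}) ∧
    divisorLevel n D 0 = scaleSet 2 (divisorLevel n D 1 \ {n / 2}) ∧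
    divisorLevel n D 0 = scaleSet 4 (divisorLevel n D 2 \ {n / 4}) := by
  have h1 : ∀ d, d ∈ divisorLevel n D 1 \ {n / 2} ↔ _ :=
    fun d => mem_divisorLevel_sdiff_iff (i := 1) hD
  have h2 : ∀ d, d ∈ divisorLevel n D 2 \ {n / 4} ↔ _ :=
    fun d => mem_divisorLevel_sdiff_iff (i := 2) hD
  have hA : divisorLevel n D 1 \ {n / 2} = scaleSet 2 (divisorLevel n D 2 \ {n / 4}) := by
    ext d
    rw [h1, scaleSet, Finset.mem_image]
    simp only [h2]
    constructor
    · rintro ⟨hd, m, hm, hm1, h⟩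
      obtain ⟨k1, k2, k3⟩ := hPST.mem_iff hD hm hm1
      have h2d := (k1 d (by rw [h]; ring)).mpr hd
      -- An odd `d` has no half; there `k3` excludes `2 * d` from `D`, against `h2d`.
      rcases Nat.even_or_odd' d with ⟨W, rfl | rfl⟩
      · refine ⟨W, ⟨(k2 W (by rw [h]; ring)).mp ?_, m, hm, hm1, by rw [h]; ring⟩, rfl⟩
        convert h2d using 1; ring
      · exact absurd h2d (k3 _ ⟨W, rfl⟩ (by rw [h]; ring))
    · rintro ⟨W, ⟨hW, m, hm, hm1, h⟩, rfl⟩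
      obtain ⟨k1, k2, -⟩ := hPST.mem_iff hD hm hm1
      refine ⟨(k1 (2 * W) (by rw [h]; ring)).mp ?_, m, hm, hm1, by rw [h]; ring⟩
      convert (k2 W (by rw [h]; ring)).mpr hW using 1; ring
  have hB : divisorLevel n D 0 = scaleSet 2 (divisorLevel n D 1 \ {n / 2}) := by
    ext d
    rw [mem_divisorLevel_zero_iff hD, scaleSet, Finset.mem_image]
    simp only [h1]
    constructor
    · rintro ⟨hd, m, hm, hm1, h⟩
      obtain ⟨k1, -, -⟩ := hPST.mem_iff hD hm hm1
      have hev : 2 ∣ m * d := by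
        have := hPST.even hD
        rwa [h, pow_zero, one_mul] at this
      obtain ⟨Y, rfl⟩ := (Nat.coprime_two_left.mpr hm).dvd_of_dvd_mul_left hev
      exact ⟨Y, ⟨(k1 Y (by rw [h]; ring)).mp hd, m, hm, hm1, by rw [h]; ring⟩, rfl⟩
    · rintro ⟨Y, ⟨hY, m, hm, hm1, h⟩, rfl⟩
      obtain ⟨k1, -, -⟩ := hPST.mem_iff hD hm hm1
      exact ⟨(k1 Y (by rw [h]; ring)).mpr hY, m, hm, hm1, by rw [h]; ring⟩
  refine ⟨hA, hB, ?_⟩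
  rw [hB, hA, scaleSet, scaleSet, scaleSet, Finset.image_image]
  refine Finset.image_congr fun d _ => ?_
  simp only [Function.comp_apply]
  ring
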